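/- Theorem 2.2. Let $d\ge 1$ be an integer. For $\lambda>0$ and a probability measure $\nu$ on $]0,+\infty[$, let $\xi$ be a Poisson point process on $\mathbb{R}^d\times\,]0,+\infty[$ whose intensity measure is the product of $\lambda$ times Lebesgue measure and $\nu$; write $P_{\lambda,\nu}$, $E_{\lambda,\nu}$ for the associated probability and expectation. Let $\Sigma=\bigcup_{(c,r)\in\xi}B(c,r)$ be the union of the open Euclidean balls with centre $c$ and radius $r$, let $S$ be the connected component of $\Sigma$ that contains the origin ($S=\emptyset$ if $0\notin\Sigma$), and let $D=\sup_{x,y\in S}\|x-y\|\in[0,+\infty]$ be its Euclidean diameter ($D=0$ if $S=\emptyset$); $D$ is a random variable. Let $s>0$. For every probability measure $\nu$ on $]0,+\infty[$, the following assertions are equivalent: 1. $\int r^{d+s}\,\nu(dr)<\infty$; 2. there exists $\lambda_0>0$ such that $E_{\lambda,\nu}(D^s)<\infty$ for all real $\lambda$ with $0<\lambda<\lambda_0$. Moreover, there exists a constant $C>0$ that depends only on $d$ such that, for all $s>0$ and all probability measures $\nu$ on $]0,+\infty[$ for which these assertions hold, $E_{\lambda,\nu}(D^s)<\infty$ for all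 real $\lambda$ with $0<\lambda<C\left(\int r^d\,\nu(dr)\right)^{-1}$. -/

import Mathlib

open MeasureTheory ProbabilityTheory
open scoped ENNReal

universe u

/-- Under `P`, the random countable set `ξ` is a Poisson point process with intensity measure `Λ`:
the number of points in a measurable set `B` is a random variable which has the Poisson law with
mean `Λ B` (it is a.s. infinite if `Λ B = ∞`), and the numbers of points in pairwise disjoint
measurable sets are independent. -/
structure IsPoissonPointProcess {X Ω : Type*} [MeasurableSpace X] [MeasurableSpace Ω]
    (ξ : Ω → Set X) (Λ : Measure X) (P : Measure Ω) : Prop where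
  isProbabilityMeasure : IsProbabilityMeasure P
  countable : ∀ ω, (ξ ω).Countable
  measurable_encard : ∀ B : Set X, MeasurableSet B → Measurable fun ω => (ξ ω ∩ B).encard
  law_of_ne_top : ∀ B : Set X, MeasurableSet B → Λ B ≠ ∞ →
    ∀ n : ℕ, P {ω | (ξ ω ∩ B).encard = n} = poissonMeasure (Λ B).toNNReal {n}
  law_of_eq_top : ∀ B : Set X, MeasurableSet B → Λ B = ∞ → ∀ᵐ ω ∂P, (ξ ω ∩ B).encard = ⊤
  indep : ∀ B : ℕ → Set X, (∀ i, MeasurableSet (B i)) → Pairwise (Function.onFun Disjoint B) →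
    iIndepFun (fun i ω => (ξ ω ∩ B i).encard) P

/-- The space `ℝ^d × ]0, +∞[` of (centre, radius) pairs. -/
abbrev MarkedSpace (d : ℕ) : Type := EuclideanSpace ℝ (Fin d) × Set.Ioi (0 : ℝ)

/-- The product of `lam` times Lebesgue measure on `ℝ^d` and of the radius distribution `ν`. -/
noncomputable def boolIntensity (d : ℕ) (lam : ℝ) (ν : Measure (Set.Ioi (0 : ℝ))) :
    Measure (MarkedSpace d) :=
  (ENNReal.ofReal lam • (volume : Measure (EuclideanSpace ℝ (Fin d)))).prod ν

/-- The occupied region: the union of the open Euclidean balls `B(c, r)`, `(c, r) ∈ η`. -/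
def occupied {d : ℕ} (η : Set (MarkedSpace d)) : Set (EuclideanSpace ℝ (Fin d)) :=
  ⋃ p ∈ η, Metric.ball p.1 (p.2 : ℝ)

/-- The connected component of the occupied region that contains the origin (empty if the origin
is not occupied). -/
def originCluster {d : ℕ} (η : Set (MarkedSpace d)) : Set (EuclideanSpace ℝ (Fin d)) :=
  connectedComponentIn (occupied η) 0

/-- The Euclidean diameter, in `[0, ∞]`, of the cluster of the origin (`0` if it is empty). -/
noncomputable def clusterDiam {d : ℕ} (η : Set (MarkedSpace d)) : ℝ≥0∞ :=
  Metric.ediam (originCluster η)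

/-- The moment `∫ r ^ p ν(dr)`, in `[0, ∞]`. -/
noncomputable def radiusMoment (ν : Measure (Set.Ioi (0 : ℝ))) (p : ℝ) : ℝ≥0∞ :=
  ∫⁻ r, ENNReal.ofReal ((r : ℝ) ^ p) ∂ν

/-!
The proof is a multiscale argument. The cluster of the origin is the set of the points that a finite
chain of overlapping balls joins to the origin (`originCluster_eq`); as the overlaps are open, the
chains can be made to pass through a countable dense set, whence the measurability of the diameter
(`measurable_clusterDiam`).

Sufficiency of the moment condition. Let `π(α)` be the supremum over `x` of the probability that
the balls with centre in `B(x, 5 α)` join `B(x, α)` to the outside of `B(x, 4 α)`. Suppose that this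
crossing occurs on the scale `10 α` and that no ball that takes part has radius `≥ α`. The chain of
balls cannot jump over an annulus of width `2 α`, so it has a point in each of two annuli that are
far apart; near each of these points a crossing on the scale `α` occurs, and such crossings are
independent since they use centres in disjoint balls. Hence
`π(10 α) ≤ N² π(α)² + c λ ∫_{r ≥ α} r ^ d ν(dr)`, where `N` and `c` depend on the dimension only
(`crossingProb_ten_mul_le`). Moreover `π(α) → 0` as `α → 0`, and if `λ ∫ r ^ d ν(dr)` is small the
source term is small on every scale, so `π(10 ^ n α)` tends to `0` and is summable with the weights
`10 ^ (n s)` as soon as the source is (`tsum_geometric_mul_ne_top_of_quadratic`), which is the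
moment condition. Finally a diameter larger than `8 α` needs a crossing on the scale `α` or a remote
ball that comes close to the origin (`measure_lt_clusterDiam_le`).

Necessity. The diameter is at least the radius of any ball that covers the origin, and the intensity
of the covering balls of radius `≥ t` is `c λ ∫_{r ≥ t} r ^ d ν(dr)`. When `t` is large this
intensity is at most twice the probability that such a ball exists
(`radiusMoment_ne_top_of_lintegral_clusterDiam`).
-/

/-! ### Chains of balls -/

/-- Two points are linked by `η` if one ball of `η` contains both of them. -/
def Linked {d : ℕ} (η : Set (MarkedSpace d)) (y z : EuclideanSpace ℝ (Fin d)) : Prop :=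
  ∃ p ∈ η, y ∈ Metric.ball p.1 (p.2 : ℝ) ∧ z ∈ Metric.ball p.1 (p.2 : ℝ)

/-- Two points are in reach of each other if a finite chain of balls of `η`, at least one ball
long, leads from the one to the other. -/
def Reach {d : ℕ} (η : Set (MarkedSpace d)) :
    EuclideanSpace ℝ (Fin d) → EuclideanSpace ℝ (Fin d) → Prop :=
  Relation.TransGen (Linked η)

section Chains

variable {d : ℕ} {η η' : Set (MarkedSpace d)} {x y z w : EuclideanSpace ℝ (Fin d)}

lemma Linked.symm (h : Linked η y z) : Linked η z y := by
  obtain ⟨p, hp, h1, h2⟩ := h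
  exact ⟨p, hp, h2, h1⟩

lemma Reach.symm (h : Reach η y z) : Reach η z y := by
  induction h with
  | single h => exact .single h.symm
  | tail _ h ih => exact .head h.symm ih

lemma isOpen_linked (η : Set (MarkedSpace d)) (y : EuclideanSpace ℝ (Fin d)) :
    IsOpen {z | Linked η y z} := by
  have : {z | Linked η y z} =
      ⋃ p ∈ {p | p ∈ η ∧ y ∈ Metric.ball p.1 (p.2 : ℝ)}, Metric.ball p.1 (p.2 : ℝ) := by
    ext z
    simp [Linked, and_assoc]
  rw [this]
  exact isOpen_biUnion fun p _ => Metric.isOpen_ball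

/-- A chain from `y` to `z` whose `n` intermediate points belong to a fixed countable dense set. -/
def ReachIn (η : Set (MarkedSpace d)) (y : EuclideanSpace ℝ (Fin d)) :
    ℕ → EuclideanSpace ℝ (Fin d) → Prop
  | 0, z => Linked η y z
  | n + 1, z => ∃ i : ℕ, ReachIn η y n (TopologicalSpace.denseSeq _ i) ∧
      Linked η (TopologicalSpace.denseSeq _ i) z

lemma isOpen_reachIn (η : Set (MarkedSpace d)) (y : EuclideanSpace ℝ (Fin d)) (n : ℕ) :
    IsOpen {z | ReachIn η y n z} := by
  cases n with
  | zero => exact isOpen_linked η y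
  | succ n =>
    have : {z | ReachIn η y (n + 1) z} =
        ⋃ i ∈ {i | ReachIn η y n (TopologicalSpace.denseSeq _ i)},
          {z | Linked η (TopologicalSpace.denseSeq _ i) z} := by
      ext z
      simp [ReachIn]
    rw [this]
    exact isOpen_biUnion fun i _ => isOpen_linked η _

/-- Two consecutive balls of a chain overlap in an open set, so the point where the chain passes
from one to the next can be moved into a countable dense set. -/
lemma reach_iff_exists_reachIn : Reach η y z ↔ ∃ n, ReachIn η y n z := by
  constructor
  · intro h
    induction h with
    | single h => exact ⟨0, h⟩
    | @tail b c _ h ih =>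
      obtain ⟨n, hn⟩ := ih
      have ho : IsOpen ({w | ReachIn η y n w} ∩ {w | Linked η c w}) :=
        (isOpen_reachIn η y n).inter (isOpen_linked η c)
      obtain ⟨i, hi⟩ := (TopologicalSpace.denseRange_denseSeq _).exists_mem_open ho ⟨b, hn, h.symm⟩
      exact ⟨n + 1, i, hi.1, Linked.symm hi.2⟩
  · rintro ⟨n, hn⟩
    induction n generalizing z with
    | zero => exact .single hn
    | succ n ih =>
      obtain ⟨i, h1, h2⟩ := hn
      exact .tail (ih h1) h2

lemma isOpen_reach (η : Set (MarkedSpace d)) (y : EuclideanSpace ℝ (Fin d)) :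
    IsOpen {z | Reach η y z} := by
  have : {z | Reach η y z} = ⋃ n, {z | ReachIn η y n z} := by
    ext z
    simp [reach_iff_exists_reachIn]
  rw [this]
  exact isOpen_iUnion fun n => isOpen_reachIn η y n

lemma Reach.left_mem_occupied (h : Reach η y z) : y ∈ occupied η := by
  obtain ⟨_, p, hp, hy, _⟩ : ∃ w, Linked η y w := by
    induction h with
    | single h => exact ⟨_, h⟩
    | tail _ _ ih => exact ih
  exact Set.mem_biUnion hp hy

lemma reach_self (h : y ∈ occupied η) : Reach η y y := by
  simp only [occupied, Set.mem_iUnion] at h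
  obtain ⟨p, hp, hy⟩ := h
  exact .single ⟨p, hp, hy, hy⟩

/-- The cluster of the origin is the set of the points that a chain of balls joins to it. -/
lemma originCluster_eq (η : Set (MarkedSpace d)) : originCluster η = {z | Reach η 0 z} := by
  apply Set.Subset.antisymm
  · intro z hz
    have h0 : (0 : EuclideanSpace ℝ (Fin d)) ∈ occupied η := by
      by_contra h
      rw [originCluster, connectedComponentIn_eq_empty h] at hz
      exact hz
    have hopen : IsOpen (⋃ w ∈ {w | w ∈ occupied η ∧ ¬ Reach η 0 w}, {z | Reach η w z}) :=
      isOpen_biUnion fun w _ => isOpen_reach η w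
    refine IsPreconnected.subset_left_of_subset_union (isOpen_reach η 0) hopen ?_ ?_ ?_
      (isPreconnected_connectedComponentIn (F := occupied η) (x := 0)) hz
    · rw [Set.disjoint_left]
      intro a ha hb
      simp only [Set.mem_iUnion] at hb
      obtain ⟨w, hw, hwa⟩ := hb
      exact hw.2 (Relation.TransGen.trans ha (Reach.symm hwa))
    · intro a ha
      have ha' := connectedComponentIn_subset _ _ ha
      by_cases h : Reach η 0 a
      · exact Or.inl h
      · exact Or.inr (Set.mem_biUnion (show a ∈ {w | w ∈ occupied η ∧ ¬ Reach η 0 w} from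
          ⟨ha', h⟩) (reach_self ha'))
    · exact ⟨0, mem_connectedComponentIn h0, reach_self h0⟩
  · intro z hz
    have h0 : (0 : EuclideanSpace ℝ (Fin d)) ∈ occupied η := Reach.left_mem_occupied hz
    have key : ∀ a b, Linked η a b → a ∈ originCluster η → b ∈ originCluster η := by
      rintro a b ⟨p, hp, ha, hb⟩ hac
      rw [originCluster, connectedComponentIn_eq hac]
      exact (convex_ball p.1 (p.2 : ℝ)).isPreconnected.subset_connectedComponentIn ha
        (Set.subset_biUnion_of_mem (u := fun p : MarkedSpace d => Metric.ball p.1 (p.2 : ℝ)) hp) hb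
    change Reach η 0 z at hz
    induction hz with
    | single h => exact key _ _ h (mem_connectedComponentIn h0)
    | tail _ h ih => exact key _ _ h ih

/-- A chain that leaves a ball does so, for the first time, by using only balls that meet it. -/
lemma Reach.localize {b : ℝ} (hη : ∀ p ∈ η, ∀ u ∈ Metric.ball p.1 (p.2 : ℝ),
      u ∈ Metric.closedBall x b → p ∈ η')
    (hy : y ∈ Metric.closedBall x b) (hz : z ∉ Metric.closedBall x b) (h : Reach η y z) :
    ∃ z', z' ∉ Metric.closedBall x b ∧ Reach η' y z' := by
  have key : ∀ z, Reach η y z → (Reach η' y z ∧ z ∈ Metric.closedBall x b) ∨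
      ∃ z', z' ∉ Metric.closedBall x b ∧ Reach η' y z' := by
    intro z h
    induction h with
    | @single c h =>
      obtain ⟨p, hp, h1, h2⟩ := h
      have hr : Reach η' y c := .single ⟨p, hη p hp _ h1 hy, h1, h2⟩
      by_cases hc : c ∈ Metric.closedBall x b
      · exact Or.inl ⟨hr, hc⟩
      · exact Or.inr ⟨c, hc, hr⟩
    | @tail a c _ h ih =>
      rcases ih with ⟨ha, hab⟩ | ih
      · obtain ⟨p, hp, h1, h2⟩ := h
        have hr : Reach η' y c := .tail ha ⟨p, hη p hp _ h1 hab, h1, h2⟩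
        by_cases hc : c ∈ Metric.closedBall x b
        · exact Or.inl ⟨hr, hc⟩
        · exact Or.inr ⟨c, hc, hr⟩
      · exact Or.inr ih
  rcases key z h with ⟨_, h⟩ | h
  · exact absurd h hz
  · exact h

/-- A chain of balls of radius less than `α` cannot jump over an annulus of width `2 α`. -/
lemma Reach.exists_mem_annulus {α R : ℝ} (hη : ∀ p ∈ η, (p.2 : ℝ) < α)
    (hy : dist y x < R) (hz : R ≤ dist z x) (h : Reach η y z) :
    ∃ w, Reach η y w ∧ R ≤ dist w x ∧ dist w x < R + 2 * α := by
  have step : ∀ a c, Linked η a c → dist a x < R → dist c x < R + 2 * α := by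
    rintro a c ⟨p, hp, h1, h2⟩ ha
    rw [Metric.mem_ball] at h1 h2
    have := hη p hp
    have h3 := dist_triangle c p.1 x
    have h4 := dist_triangle_left p.1 x a
    linarith
  have key : ∀ z, Reach η y z → dist z x < R ∨
      ∃ w, Reach η y w ∧ R ≤ dist w x ∧ dist w x < R + 2 * α := by
    intro z h
    induction h with
    | @single c h =>
      rcases lt_or_ge (dist c x) R with hc | hc
      · exact Or.inl hc
      · exact Or.inr ⟨c, .single h, hc, step _ _ h hy⟩
    | @tail a c h' h ih =>
      rcases ih with ha | ih
      · rcases lt_or_ge (dist c x) R with hc | hc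
        · exact Or.inl hc
        · exact Or.inr ⟨c, .tail h' h, hc, step _ _ h ha⟩
      · exact Or.inr ih
  rcases key z h with h | h
  · exact absurd h (not_lt.2 hz)
  · exact h

end Chains

/-! ### Local crossings -/

/-- The pairs whose centre lies in the ball with centre `x` and radius `ρ`. -/
def centresIn {d : ℕ} (x : EuclideanSpace ℝ (Fin d)) (ρ : ℝ) : Set (MarkedSpace d) :=
  {p | p.1 ∈ Metric.ball x ρ}

/-- The local crossing event at `x` on the scale `α`: the balls of `η` with centre in
`B(x, 5 α)` alone join `B(x, α)` to the complement of the closed ball `B̄(x, 4 α)`. -/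
def LocalCrossing {d : ℕ} (η : Set (MarkedSpace d)) (x : EuclideanSpace ℝ (Fin d)) (α : ℝ) :
    Prop :=
  ∃ y ∈ Metric.ball x α, ∃ z ∈ (Metric.closedBall x (4 * α))ᶜ,
    Reach (η ∩ centresIn x (5 * α)) y z

section Crossing

variable {d : ℕ} {η : Set (MarkedSpace d)} {x : EuclideanSpace ℝ (Fin d)} {α : ℝ}

lemma LocalCrossing.nonempty (h : LocalCrossing η x α) :
    (η ∩ centresIn x (5 * α)).Nonempty := by
  obtain ⟨y, _, z, _, h⟩ := h
  have := h.left_mem_occupied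
  simp only [occupied, Set.mem_iUnion] at this
  obtain ⟨p, hp, _⟩ := this
  exact ⟨p, hp⟩

/-- A chain that leads from near `x` to far from `x` realises the local crossing event if all its
balls that come close to `x` have their centres there: the chain is cut when it first leaves
`B̄(x, 4 α)`. -/
lemma LocalCrossing.of_reach {y z : EuclideanSpace ℝ (Fin d)} {η' : Set (MarkedSpace d)}
    (hη : η' ⊆ η) (hα : 0 < α)
    (hr : ∀ p ∈ η', ∀ u ∈ Metric.ball p.1 (p.2 : ℝ), u ∈ Metric.closedBall x (4 * α) →
      p.1 ∈ Metric.ball x (5 * α))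
    (hy : y ∈ Metric.ball x α) (hz : z ∉ Metric.closedBall x (4 * α)) (h : Reach η' y z) :
    LocalCrossing η x α := by
  have hy' : y ∈ Metric.closedBall x (4 * α) := by
    rw [Metric.mem_ball] at hy
    rw [Metric.mem_closedBall]
    linarith
  obtain ⟨z', hz', h'⟩ := h.localize (η' := η ∩ centresIn x (5 * α))
    (fun p hp u hu hux => ⟨hη hp, hr p hp u hu hux⟩) hy' hz
  exact ⟨y, hy, z', hz', h'⟩

/-- The geometric heart of the scale recursion: in the absence of large balls, a crossing on the
scale `10 α` forces crossings on the scale `α` at two places, one near each of two annuli that are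
far apart. -/
lemma LocalCrossing.exists_pair {K : Finset (EuclideanSpace ℝ (Fin d))} (hα : 0 < α)
    (hK : Metric.closedBall 0 40 ⊆ ⋃ k ∈ K, Metric.ball k 1)
    (hsmall : ∀ p ∈ η, p ∈ centresIn x (50 * α) → (p.2 : ℝ) < α)
    (h : LocalCrossing η x (10 * α)) :
    ∃ k ∈ K, ∃ l ∈ K, ‖k‖ < 13 ∧ 29 < ‖l‖ ∧ LocalCrossing η (x + α • k) α ∧
      LocalCrossing η (x + α • l) α := by
  obtain ⟨y, hy, z, hz, h⟩ := h
  rw [show 5 * (10 * α) = 50 * α by ring] at h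
  rw [Metric.mem_ball] at hy
  simp only [Set.mem_compl_iff, Metric.mem_closedBall, not_le] at hz
  set η' := η ∩ centresIn x (50 * α) with hη'
  have hs : ∀ p ∈ η', (p.2 : ℝ) < α := fun p hp => hsmall p hp.1 hp.2
  obtain ⟨w₁, h1, hw1, hw1'⟩ := h.exists_mem_annulus (x := x) (R := 10 * α) hs hy (by linarith)
  obtain ⟨w₂, h2, hw2, hw2'⟩ := h.exists_mem_annulus (x := x) (R := 30 * α) hs (by linarith)
    (by linarith)
  -- the two points lie in the annuli with radii `10 α`, `12 α` and `30 α`, `32 α`: they are far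
  -- apart, and so are the centres that crossings near them can use
  have h12 : Reach η' w₁ w₂ := Relation.TransGen.trans h1.symm h2
  -- every point at distance at most `40 α` from `x` is close to a rescaled point of `K`
  have cover : ∀ w, dist w x ≤ 40 * α → ∃ k ∈ K, dist w (x + α • k) < α := by
    intro w hw
    have hm : α⁻¹ • (w - x) ∈ Metric.closedBall (0 : EuclideanSpace ℝ (Fin d)) 40 := by
      rw [mem_closedBall_zero_iff, norm_smul, Real.norm_of_nonneg (inv_nonneg.2 hα.le),
        ← dist_eq_norm, inv_mul_le_iff₀ hα]
      linarith
    have := hK hm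
    simp only [Set.mem_iUnion] at this
    obtain ⟨k, hk, hwk⟩ := this
    refine ⟨k, hk, ?_⟩
    have e : w - (x + α • k) = α • (α⁻¹ • (w - x) - k) := by
      rw [smul_sub, smul_inv_smul₀ hα.ne']
      abel
    rw [Metric.mem_ball, dist_eq_norm] at hwk
    rw [dist_eq_norm, e, norm_smul, Real.norm_of_nonneg hα.le]
    nlinarith
  obtain ⟨k, hk, hwk⟩ := cover w₁ (by linarith)
  obtain ⟨l, hl, hwl⟩ := cover w₂ (by linarith)
  have dk : ∀ k : EuclideanSpace ℝ (Fin d), dist (x + α • k) x = α * ‖k‖ := fun k => by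
    rw [dist_eq_norm, add_sub_cancel_left, norm_smul, Real.norm_of_nonneg hα.le]
  have hw12 : 18 * α < dist w₁ w₂ := by
    have := dist_triangle_left w₂ x w₁
    linarith
  have hloc : ∀ c, ∀ p ∈ η', ∀ u ∈ Metric.ball p.1 (p.2 : ℝ), u ∈ Metric.closedBall c (4 * α) →
      p.1 ∈ Metric.ball c (5 * α) := by
    intro c p hp u hu huc
    rw [Metric.mem_ball] at hu ⊢
    rw [Metric.mem_closedBall] at huc
    have := hs p hp
    have := dist_triangle_left p.1 c u
    linarith
  refine ⟨k, hk, l, hl, ?_, ?_, ?_, ?_⟩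
  · have := dist_triangle_left (x + α • k) x w₁
    rw [dk] at this
    nlinarith
  · have := dist_triangle w₂ (x + α • l) x
    rw [dk] at this
    nlinarith
  · refine LocalCrossing.of_reach Set.inter_subset_left hα (hloc _) hwk ?_ h12
    rw [Metric.mem_closedBall, not_le]
    have := dist_triangle_right w₁ w₂ (x + α • k)
    linarith
  · refine LocalCrossing.of_reach Set.inter_subset_left hα (hloc _) hwl ?_ h12.symm
    rw [Metric.mem_closedBall, not_le]
    have := dist_triangle_right w₁ w₂ (x + α • l)
    linarith

/-- If the cluster of the origin is large, then there is a local crossing at the origin, or a ball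
with a remote centre comes close to the origin. -/
lemma localCrossing_or_of_lt_clusterDiam (hα : 0 < α)
    (h : ENNReal.ofReal (8 * α) < clusterDiam η) :
    LocalCrossing η 0 α ∨ (η ∩ {p | dist p.1 0 < 5 * (p.2 : ℝ) ∧ α ≤ (p.2 : ℝ)}).Nonempty := by
  by_contra! hcon
  obtain ⟨h1, h2⟩ := hcon
  obtain ⟨z, hz, hz'⟩ : ∃ z, Reach η 0 z ∧ z ∉ Metric.closedBall 0 (4 * α) := by
    by_contra! hc
    refine h.not_ge ?_
    have hsub : originCluster η ⊆ Metric.closedBall 0 (4 * α) := by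
      rw [originCluster_eq]
      exact fun z hz => hc z hz
    refine (Metric.ediam_mono hsub).trans ?_
    refine Metric.ediam_le_of_forall_dist_le fun a ha b hb => ?_
    rw [Metric.mem_closedBall] at ha hb
    have := dist_triangle_right a b 0
    linarith
  refine h1 (LocalCrossing.of_reach subset_rfl hα ?_ (Metric.mem_ball_self hα) hz' hz)
  intro p hp u hu hu0
  rw [Metric.mem_ball] at hu ⊢
  rw [Metric.mem_closedBall] at hu0
  by_contra hlt
  rw [not_lt] at hlt
  have := dist_triangle_left p.1 0 u
  have hmem : p ∈ η ∩ {p | dist p.1 0 < 5 * (p.2 : ℝ) ∧ α ≤ (p.2 : ℝ)} :=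
    ⟨hp, by linarith, by linarith⟩
  rw [h2] at hmem
  exact hmem

/-- A ball that covers the origin is part of its cluster. -/
lemma le_clusterDiam (hd : 1 ≤ d) {p : MarkedSpace d} (hp : p ∈ η) (h0 : dist 0 p.1 < (p.2 : ℝ)) :
    ENNReal.ofReal (p.2 : ℝ) ≤ clusterDiam η := by
  have : Nonempty (Fin d) := ⟨⟨0, hd⟩⟩
  have hsub : Metric.ball p.1 (p.2 : ℝ) ⊆ originCluster η := by
    rw [originCluster_eq]
    exact fun z hz => .single ⟨p, hp, h0, hz⟩
  refine le_trans ?_ (Metric.ediam_mono hsub)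
  have hr : (0 : ℝ) < p.2 := p.2.2
  have hdiam := Metric.diam_ball_eq p.1 hr.le
  rw [← ENNReal.ofReal_toReal (Metric.isBounded_ball (x := p.1) (r := (p.2 : ℝ))).ediam_ne_top]
  apply ENNReal.ofReal_le_ofReal
  change (p.2 : ℝ) ≤ Metric.diam _
  rw [hdiam]
  linarith

end Crossing

/-! ### Measurability -/

section Measurability

variable {d : ℕ} {Ω : Type*} {m : MeasurableSpace Ω} {ξ : Ω → Set (MarkedSpace d)}

lemma measurableSet_centresIn (x : EuclideanSpace ℝ (Fin d)) (ρ : ℝ) :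
    MeasurableSet (centresIn x ρ) :=
  measurable_fst Metric.isOpen_ball.measurableSet

lemma measurableSet_linked
    (hξ : ∀ B, MeasurableSet B → MeasurableSet[m] {ω | (ξ ω ∩ B).Nonempty})
    (y z : EuclideanSpace ℝ (Fin d)) : MeasurableSet[m] {ω | Linked (ξ ω) y z} := by
  have hB : ∀ y : EuclideanSpace ℝ (Fin d),
      MeasurableSet {p : MarkedSpace d | y ∈ Metric.ball p.1 (p.2 : ℝ)} := fun y =>
    measurableSet_lt (f := fun p : MarkedSpace d => dist y p.1)
      (g := fun p : MarkedSpace d => (p.2 : ℝ)) (by fun_prop) (by fun_prop)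
  exact hξ _ ((hB y).inter (hB z))

lemma measurableSet_reach
    (hξ : ∀ B, MeasurableSet B → MeasurableSet[m] {ω | (ξ ω ∩ B).Nonempty})
    (y z : EuclideanSpace ℝ (Fin d)) : MeasurableSet[m] {ω | Reach (ξ ω) y z} := by
  simp only [reach_iff_exists_reachIn, Set.ofPred_exists]
  refine MeasurableSet.iUnion fun n => ?_
  induction n generalizing z with
  | zero => exact measurableSet_linked hξ y z
  | succ n ih =>
    simp only [ReachIn, Set.ofPred_exists]
    exact MeasurableSet.iUnion fun i => (ih _).inter (measurableSet_linked hξ _ z)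

/-- Reach is an open relation, so joined points of two open sets can be chosen in a countable dense
set. -/
lemma exists_reach_iff_denseSeq {η : Set (MarkedSpace d)} {U V : Set (EuclideanSpace ℝ (Fin d))}
    (hU : IsOpen U) (hV : IsOpen V) :
    (∃ y ∈ U, ∃ z ∈ V, Reach η y z) ↔
      ∃ i j : ℕ, TopologicalSpace.denseSeq _ i ∈ U ∧ TopologicalSpace.denseSeq _ j ∈ V ∧
        Reach η (TopologicalSpace.denseSeq _ i) (TopologicalSpace.denseSeq _ j) := by
  constructor
  · rintro ⟨y, hy, z, hz, h⟩
    obtain ⟨i, hi⟩ := (TopologicalSpace.denseRange_denseSeq _).exists_mem_open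
      (hU.inter (isOpen_reach η z)) ⟨y, hy, h.symm⟩
    have hi' := Reach.symm hi.2
    obtain ⟨j, hj⟩ := (TopologicalSpace.denseRange_denseSeq _).exists_mem_open
      (hV.inter (isOpen_reach η _)) ⟨z, hz, hi'⟩
    exact ⟨i, j, hi.1, hj.1, hj.2⟩
  · rintro ⟨i, j, hi, hj, h⟩
    exact ⟨_, hi, _, hj, h⟩

lemma measurableSet_localCrossing (x : EuclideanSpace ℝ (Fin d)) (α : ℝ)
    (hξ : ∀ B, MeasurableSet B → B ⊆ centresIn x (5 * α) →
      MeasurableSet[m] {ω | (ξ ω ∩ B).Nonempty}) :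
    MeasurableSet[m] {ω | LocalCrossing (ξ ω) x α} := by
  have hξ' : ∀ B, MeasurableSet B →
      MeasurableSet[m] {ω | ((ξ ω ∩ centresIn x (5 * α)) ∩ B).Nonempty} := by
    intro B hB
    simp only [Set.inter_assoc]
    exact hξ _ ((measurableSet_centresIn _ _).inter hB) Set.inter_subset_left
  have : {ω | LocalCrossing (ξ ω) x α} = ⋃ i : ℕ, ⋃ j : ℕ, {ω |
      TopologicalSpace.denseSeq _ i ∈ Metric.ball x α ∧
      TopologicalSpace.denseSeq _ j ∈ (Metric.closedBall x (4 * α))ᶜ ∧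
      Reach (ξ ω ∩ centresIn x (5 * α)) (TopologicalSpace.denseSeq _ i)
        (TopologicalSpace.denseSeq _ j)} := by
    ext ω
    simp only [Set.mem_ofPred_eq, Set.mem_iUnion, LocalCrossing]
    exact exists_reach_iff_denseSeq Metric.isOpen_ball Metric.isClosed_closedBall.isOpen_compl
  rw [this]
  refine MeasurableSet.iUnion fun i => MeasurableSet.iUnion fun j => ?_
  exact (MeasurableSet.const _).inter ((MeasurableSet.const _).inter (measurableSet_reach hξ' _ _))

lemma measurable_clusterDiam
    (hξ : ∀ B, MeasurableSet B → MeasurableSet[m] {ω | (ξ ω ∩ B).Nonempty}) :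
    Measurable fun ω => clusterDiam (ξ ω) := by
  refine measurable_of_Ioi fun a => ?_
  have : (fun ω => clusterDiam (ξ ω)) ⁻¹' Set.Ioi a = ⋃ i : ℕ, ⋃ j : ℕ, {ω |
      a < edist (TopologicalSpace.denseSeq (EuclideanSpace ℝ (Fin d)) i)
        (TopologicalSpace.denseSeq _ j) ∧
      Reach (ξ ω) 0 (TopologicalSpace.denseSeq _ i) ∧
      Reach (ξ ω) 0 (TopologicalSpace.denseSeq _ j)} := by
    ext ω
    simp only [Set.mem_preimage, Set.mem_Ioi, Set.mem_iUnion, Set.mem_ofPred_eq, clusterDiam,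
      originCluster_eq]
    constructor
    · intro h
      obtain ⟨y, hy, z, hz, hyz⟩ : ∃ y, Reach (ξ ω) 0 y ∧ ∃ z, Reach (ξ ω) 0 z ∧ a < edist y z := by
        by_contra! hc
        exact h.not_ge (Metric.ediam_le fun y hy z hz => hc y hy z hz)
      have ho := isOpen_reach (ξ ω) (0 : EuclideanSpace ℝ (Fin d))
      have ho1 : IsOpen {y' | a < edist y' z} :=
        isOpen_lt continuous_const (continuous_id.edist continuous_const)
      obtain ⟨i, hi⟩ := (TopologicalSpace.denseRange_denseSeq _).exists_mem_open
        (ho.inter ho1) ⟨y, hy, hyz⟩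
      have ho2 : IsOpen {z' | a < edist
          (TopologicalSpace.denseSeq (EuclideanSpace ℝ (Fin d)) i) z'} :=
        isOpen_lt continuous_const (continuous_const.edist continuous_id)
      obtain ⟨j, hj⟩ := (TopologicalSpace.denseRange_denseSeq _).exists_mem_open
        (ho.inter ho2) ⟨z, hz, hi.2⟩
      exact ⟨i, j, hj.2, hi.1, hj.1⟩
    · rintro ⟨i, j, h, hi, hj⟩
      exact h.trans_le (Metric.edist_le_ediam_of_mem hi hj)
  rw [this]
  refine MeasurableSet.iUnion fun i => MeasurableSet.iUnion fun j => ?_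
  exact (MeasurableSet.const _).inter
    ((measurableSet_reach hξ _ _).inter (measurableSet_reach hξ _ _))

end Measurability

/-! ### Void events of a Poisson point process -/

section Poisson

/-- The events that `ξ` has no point in `B`, where `B` runs through the measurable subsets of
`A`. -/
def voidEvents {X Ω : Type*} [MeasurableSpace X] (ξ : Ω → Set X) (A : Set X) : Set (Set Ω) :=
  {E | ∃ B, MeasurableSet B ∧ B ⊆ A ∧ E = {ω | ξ ω ∩ B = ∅}}

lemma isPiSystem_voidEvents {X Ω : Type*} [MeasurableSpace X] (ξ : Ω → Set X)
    (A : Set X) : IsPiSystem (voidEvents ξ A) := by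
  rintro _ ⟨B, hB, hBA, rfl⟩ _ ⟨B', hB', hBA', rfl⟩ _
  refine ⟨B ∪ B', hB.union hB', Set.union_subset hBA hBA', ?_⟩
  ext ω
  simp [Set.inter_union_distrib_left]

lemma measurableSet_nonempty_voidEvents {X Ω : Type*} [MeasurableSpace X] (ξ : Ω → Set X)
    {A B : Set X} (hB : MeasurableSet B) (hBA : B ⊆ A) :
    MeasurableSet[MeasurableSpace.generateFrom (voidEvents ξ A)] {ω | (ξ ω ∩ B).Nonempty} := by
  have : {ω | (ξ ω ∩ B).Nonempty} = {ω | ξ ω ∩ B = ∅}ᶜ := by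
    ext ω
    simp [Set.nonempty_iff_ne_empty]
  rw [this]
  exact (MeasurableSpace.measurableSet_generateFrom
    (show {ω | ξ ω ∩ B = ∅} ∈ voidEvents ξ A from ⟨B, hB, hBA, rfl⟩)).compl

variable {X Ω : Type*} [MeasurableSpace X] [MeasurableSpace Ω] {ξ : Ω → Set X} {Λ : Measure X}
  {P : Measure Ω}

namespace IsPoissonPointProcess

lemma measurableSet_nonempty (h : IsPoissonPointProcess ξ Λ P) {B : Set X}
    (hB : MeasurableSet B) : MeasurableSet {ω | (ξ ω ∩ B).Nonempty} := by
  have : {ω | (ξ ω ∩ B).Nonempty} = (fun ω => (ξ ω ∩ B).encard) ⁻¹' {0}ᶜ := by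
    ext ω
    simp [Set.nonempty_iff_ne_empty]
  rw [this]
  exact h.measurable_encard B hB (MeasurableSet.of_discrete)

lemma measure_nonempty_of_ne_top (h : IsPoissonPointProcess ξ Λ P) {B : Set X}
    (hB : MeasurableSet B) (hΛ : Λ B ≠ ∞) :
    P {ω | (ξ ω ∩ B).Nonempty} = ENNReal.ofReal (1 - Real.exp (-(Λ B).toReal)) := by
  have := h.isProbabilityMeasure
  have h0 := h.law_of_ne_top B hB hΛ 0
  have hc : {ω | (ξ ω ∩ B).Nonempty} = {ω | (ξ ω ∩ B).encard = ((0 : ℕ) : ℕ∞)}ᶜ := by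
    ext ω
    simp [Set.nonempty_iff_ne_empty]
  have hm : MeasurableSet {ω | (ξ ω ∩ B).encard = ((0 : ℕ) : ℕ∞)} :=
    h.measurable_encard B hB (MeasurableSet.of_discrete (s := {((0 : ℕ) : ℕ∞)}))
  rw [hc, prob_compl_eq_one_sub hm, h0, poissonMeasure_singleton]
  rw [← ENNReal.ofReal_one, ← ENNReal.ofReal_sub _ (by positivity)]
  simp [ENNReal.toReal]

lemma measure_nonempty_le (h : IsPoissonPointProcess ξ Λ P) {B : Set X}
    (hB : MeasurableSet B) : P {ω | (ξ ω ∩ B).Nonempty} ≤ Λ B := by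
  by_cases hΛ : Λ B = ∞
  · simp [hΛ]
  rw [h.measure_nonempty_of_ne_top hB hΛ]
  refine ENNReal.ofReal_le_of_le_toReal ?_
  have := Real.add_one_le_exp (-(Λ B).toReal)
  linarith

/-- A set that is hit with probability at most `1 / 2` has an intensity comparable to that
probability. -/
lemma le_two_mul_measure_nonempty (h : IsPoissonPointProcess ξ Λ P) {B : Set X}
    (hB : MeasurableSet B) (hP : P {ω | (ξ ω ∩ B).Nonempty} ≤ 2⁻¹) :
    Λ B ≤ 2 * P {ω | (ξ ω ∩ B).Nonempty} := by
  have := h.isProbabilityMeasure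
  by_cases hΛ : Λ B = ∞
  · have h1 : P {ω | (ξ ω ∩ B).Nonempty} = 1 := by
      refine le_antisymm prob_le_one ?_
      rw [← measure_univ (μ := P)]
      refine measure_mono_ae ?_
      filter_upwards [h.law_of_eq_top B hB hΛ] with ω hω _
      refine Set.nonempty_iff_ne_empty.2 fun h0 => ?_
      simp [h0] at hω
    rw [h1] at hP
    exact absurd hP (by simp)
  rw [h.measure_nonempty_of_ne_top hB hΛ] at hP ⊢
  set m := (Λ B).toReal with hm
  have hexp : 2⁻¹ ≤ Real.exp (-m) := by
    have h2 : (2⁻¹ : ℝ≥0∞) = ENNReal.ofReal 2⁻¹ := by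
      rw [ENNReal.ofReal_inv_of_pos (by norm_num)]; simp
    rw [h2, ENNReal.ofReal_le_ofReal_iff (by norm_num)] at hP
    linarith
  -- `m = log (exp m) ≤ exp m - 1 = exp m * (1 - exp (-m))` with `exp m ≤ 2`
  have h1 := Real.add_one_le_exp m
  have h2 : Real.exp m * Real.exp (-m) = 1 := by rw [← Real.exp_add]; simp
  have h3 := Real.exp_pos m
  have h4 : Real.exp (-m) ≤ 1 := Real.exp_le_one_iff.2 (by simp [hm])
  have h5 : Real.exp m ≤ 2 := by nlinarith
  have h6 : m ≤ 2 * (1 - Real.exp (-m)) := by nlinarith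
  rw [← ENNReal.ofReal_toReal hΛ, ← hm]
  have : (2 : ℝ≥0∞) = ENNReal.ofReal 2 := by simp
  rw [this, ← ENNReal.ofReal_mul (by norm_num)]
  exact ENNReal.ofReal_le_ofReal h6

end IsPoissonPointProcess

/-- The restrictions of a Poisson point process to disjoint sets are independent. Void events form
a π-system, so their independence, an instance of the definition, is enough. -/
lemma IsPoissonPointProcess.indep_voidEvents (h : IsPoissonPointProcess ξ Λ P) {A A' : Set X}
    (hA : Disjoint A A') :
    Indep (MeasurableSpace.generateFrom (voidEvents ξ A))
      (MeasurableSpace.generateFrom (voidEvents ξ A')) P := by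
  have := h.isProbabilityMeasure
  have hm : ∀ A, ∀ E ∈ voidEvents ξ A, MeasurableSet E := by
    rintro A _ ⟨B, hB, _, rfl⟩
    have := (h.measurableSet_nonempty hB).compl
    convert this using 1
    ext ω
    simp [Set.nonempty_iff_ne_empty]
  refine IndepSets.indep' (hm A) (hm A') (isPiSystem_voidEvents ξ A) (isPiSystem_voidEvents ξ A') ?_
  rw [IndepSets_iff]
  rintro _ _ ⟨B, hB, hBA, rfl⟩ ⟨B', hB', hBA', rfl⟩
  have hdisj : Disjoint B B' := hA.mono hBA hBA'
  let C : ℕ → Set X := fun i => if i = 0 then B else if i = 1 then B' else ∅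
  have hC : ∀ i, MeasurableSet (C i) := by
    intro i
    simp only [C]
    split_ifs
    exacts [hB, hB', MeasurableSet.empty]
  have hCd : Pairwise (Function.onFun Disjoint C) := by
    intro i j hij
    simp only [Function.onFun, C]
    split_ifs <;> first | omega | exact hdisj | exact hdisj.symm | simp
  have hi := (h.indep C hC hCd).indepFun (zero_ne_one)
  have := hi.measure_inter_preimage_eq_mul {0} {0} MeasurableSet.of_discrete
    MeasurableSet.of_discrete
  simpa [C, Set.preimage] using this

end Poisson

/-! ### Intensity of sets of balls -/

section Intensity

variable {d : ℕ} {ν : Measure (Set.Ioi (0 : ℝ))}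

/-- The measure `r ^ d ν(dr)`: up to constants, the intensity of the balls that cover a given
point, as a function of the radius. -/
noncomputable def coveringMeasure (d : ℕ) (ν : Measure (Set.Ioi (0 : ℝ))) :
    Measure (Set.Ioi (0 : ℝ)) :=
  ν.withDensity fun r => ENNReal.ofReal ((r : ℝ) ^ d)

lemma coveringMeasure_univ : coveringMeasure d ν Set.univ = radiusMoment ν d := by
  simp [coveringMeasure, radiusMoment]

lemma lintegral_rpow_coveringMeasure (s : ℝ) :
    ∫⁻ r, ENNReal.ofReal (r : ℝ) ^ s ∂(coveringMeasure d ν) = radiusMoment ν (d + s) := by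
  rw [coveringMeasure, lintegral_withDensity_eq_lintegral_mul _ (by fun_prop) (by fun_prop),
    radiusMoment]
  refine lintegral_congr fun r => ?_
  have hr : (0 : ℝ) < r := r.2
  rw [Pi.mul_apply, ENNReal.ofReal_rpow_of_pos hr, ← ENNReal.ofReal_mul (by positivity),
    Real.rpow_add hr, Real.rpow_natCast]

lemma boolIntensity_apply [IsProbabilityMeasure ν] (lam : ℝ) {B : Set (MarkedSpace d)}
    (hB : MeasurableSet B) :
    boolIntensity d lam ν B =
      ENNReal.ofReal lam * ∫⁻ r, volume {c | ((c, r) : MarkedSpace d) ∈ B} ∂ν := by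
  rw [boolIntensity, Measure.prod_smul_left, Measure.smul_apply, Measure.prod_apply_symm hB]
  rfl

lemma boolIntensity_centresIn [IsProbabilityMeasure ν] (lam : ℝ) (x : EuclideanSpace ℝ (Fin d))
    {ρ : ℝ} (hρ : 0 < ρ) :
    boolIntensity d lam ν (centresIn x ρ) = ENNReal.ofReal lam *
      (ENNReal.ofReal (ρ ^ d) * volume (Metric.ball (0 : EuclideanSpace ℝ (Fin d)) 1)) := by
  rw [boolIntensity_apply lam (measurableSet_centresIn x ρ)]
  have : ∀ r : Set.Ioi (0 : ℝ), {c | ((c, r) : MarkedSpace d) ∈ centresIn x ρ} =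
      Metric.ball x ρ := fun r => rfl
  simp only [this, lintegral_const, measure_univ, mul_one]
  rw [Measure.addHaar_ball_of_pos _ _ hρ]
  simp

/-- The pairs for which the ball with centre `c` and radius `a r` contains `x`, and `r ≥ t`. -/
def bigBalls {d : ℕ} (x : EuclideanSpace ℝ (Fin d)) (a t : ℝ) : Set (MarkedSpace d) :=
  {p | dist p.1 x < a * (p.2 : ℝ) ∧ t ≤ (p.2 : ℝ)}

lemma measurableSet_bigBalls (x : EuclideanSpace ℝ (Fin d)) (a t : ℝ) :
    MeasurableSet (bigBalls x a t) :=
  (measurableSet_lt (f := fun p : MarkedSpace d => dist p.1 x)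
    (g := fun p : MarkedSpace d => a * (p.2 : ℝ)) (by fun_prop) (by fun_prop)).inter
    (measurableSet_le (f := fun _ : MarkedSpace d => t)
    (g := fun p : MarkedSpace d => (p.2 : ℝ)) (by fun_prop) (by fun_prop))

lemma boolIntensity_bigBalls [IsProbabilityMeasure ν] (lam : ℝ) (x : EuclideanSpace ℝ (Fin d))
    {a : ℝ} (ha : 0 < a) (t : ℝ) :
    boolIntensity d lam ν (bigBalls x a t) = ENNReal.ofReal lam *
      (ENNReal.ofReal (a ^ d) * volume (Metric.ball (0 : EuclideanSpace ℝ (Fin d)) 1)) *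
      coveringMeasure d ν {r | t ≤ (r : ℝ)} := by
  have hm : MeasurableSet {r : Set.Ioi (0 : ℝ) | t ≤ (r : ℝ)} :=
    measurableSet_le measurable_const measurable_subtype_coe
  rw [boolIntensity_apply lam (measurableSet_bigBalls x a t), coveringMeasure,
    withDensity_apply _ hm, ← lintegral_indicator hm, mul_assoc,
    ← lintegral_const_mul _ ((by fun_prop : Measurable _).indicator hm)]
  congr 1
  refine lintegral_congr fun r => ?_
  have hr : (0 : ℝ) < r := r.2
  by_cases ht : t ≤ (r : ℝ)
  · have : {c | ((c, r) : MarkedSpace d) ∈ bigBalls x a t} = Metric.ball x (a * r) := by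
      ext c
      simp [bigBalls, ht]
    rw [this, Measure.addHaar_ball_of_pos _ _ (by positivity), Set.indicator_of_mem (by exact ht),
      finrank_euclideanSpace_fin, mul_pow, ENNReal.ofReal_mul (by positivity)]
    ring
  · have : {c | ((c, r) : MarkedSpace d) ∈ bigBalls x a t} = ∅ := by
      ext c
      simp [bigBalls, ht]
    rw [this, Set.indicator_of_notMem (by exact ht)]
    simp

end Intensity

/-! ### Sums over scales -/

section Scales

/-- A discrete Gronwall bound. -/
lemma tsum_ne_top_of_le_half {u h : ℕ → ℝ≥0∞} (h0 : u 0 ≠ ∞)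
    (hrec : ∀ n, u (n + 1) ≤ 2⁻¹ * u n + h n) (hh : ∑' n, h n ≠ ∞) : ∑' n, u n ≠ ∞ := by
  set T := 2 * (u 0 + ∑' n, h n) with hT
  have hTt : T ≠ ∞ := ENNReal.mul_ne_top (by simp) (ENNReal.add_ne_top.2 ⟨h0, hh⟩)
  have hhalf : 2⁻¹ * T = u 0 + ∑' n, h n := by
    rw [hT, ← mul_assoc, ENNReal.inv_mul_cancel (by simp) (by simp), one_mul]
  refine ne_top_of_le_ne_top hTt (ENNReal.tsum_le_of_sum_range_le fun N => ?_)
  induction N with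
  | zero => simp
  | succ N ih =>
    rw [Finset.sum_range_succ']
    calc ∑ n ∈ Finset.range N, u (n + 1) + u 0
        ≤ ∑ n ∈ Finset.range N, (2⁻¹ * u n + h n) + u 0 := by gcongr; exact hrec _
      _ = 2⁻¹ * ∑ n ∈ Finset.range N, u n + ∑ n ∈ Finset.range N, h n + u 0 := by
          rw [Finset.sum_add_distrib, Finset.mul_sum]
      _ ≤ 2⁻¹ * T + ∑' n, h n + u 0 := by gcongr; exact ENNReal.sum_le_tsum _
      _ = 2⁻¹ * T + 2⁻¹ * T := by rw [add_assoc, add_comm (∑' n, h n), ← hhalf]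
      _ = T := by rw [← add_mul, ENNReal.inv_two_add_inv_two, one_mul]

/-- A sequence that starts below `1 / 2` and obeys a quadratic recursion with a small source term
inherits every geometric weight under which the source is summable: the sequence tends to `0`, so
the quadratic term is eventually an arbitrarily small multiple of the linear one. -/
lemma tsum_geometric_mul_ne_top_of_quadratic {a h : ℕ → ℝ≥0∞} {K : ℝ≥0∞} (hK : 1 ≤ K)
    (hKt : K ≠ ∞) (h0 : a 0 ≤ 2⁻¹) (hrec : ∀ n, a (n + 1) ≤ a n ^ 2 + h n) (hh : ∀ n, h n ≤ 4⁻¹)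
    (hs : ∑' n, K ^ n * h n ≠ ∞) : ∑' n, K ^ n * a n ≠ ∞ := by
  have h4 : (2⁻¹ : ℝ≥0∞) ^ 2 + 4⁻¹ = 2⁻¹ := by
    rw [← ENNReal.toReal_eq_toReal_iff' (by simp) (by simp), ENNReal.toReal_add (by simp) (by simp)]
    norm_num
  have hhalf : ∀ n, a n ≤ 2⁻¹ := by
    intro n
    induction n with
    | zero => exact h0
    | succ n ih =>
      calc a (n + 1) ≤ a n ^ 2 + h n := hrec n
        _ ≤ 2⁻¹ ^ 2 + 4⁻¹ := by gcongr; exact hh n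
        _ = 2⁻¹ := h4
  have hfin : ∀ n, a n ≠ ∞ := fun n => ne_top_of_le_ne_top (by simp) (hhalf n)
  have hsum : ∑' n, a n ≠ ∞ := by
    refine tsum_ne_top_of_le_half (h := h) (hfin 0) (fun n => (hrec n).trans ?_) ?_
    · gcongr
      rw [sq]
      gcongr
      exact hhalf n
    · refine ne_top_of_le_ne_top hs (ENNReal.tsum_le_tsum fun n => ?_)
      exact le_mul_of_one_le_left zero_le (one_le_pow₀ hK)
  have hlim := ENNReal.tendsto_atTop_zero_of_tsum_ne_top hsum
  have hε : (0 : ℝ≥0∞) < (2 * K)⁻¹ := ENNReal.inv_pos.2 (ENNReal.mul_ne_top (by simp) hKt)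
  obtain ⟨n₀, hn₀⟩ := Filter.eventually_atTop.1 (hlim.eventually (gt_mem_nhds hε))
  have hK0 : K ≠ 0 := (zero_lt_one.trans_le hK).ne'
  have htail : ∑' n, K ^ (n + n₀) * a (n + n₀) ≠ ∞ := by
    refine tsum_ne_top_of_le_half (h := fun n => K * (K ^ (n + n₀) * h (n + n₀))) ?_ ?_ ?_
    · exact ENNReal.mul_ne_top (ENNReal.pow_ne_top hKt) (hfin _)
    · intro n
      have e : K * (2 * K)⁻¹ = 2⁻¹ := by
        rw [ENNReal.mul_inv (by simp) (by simp), mul_comm, mul_assoc,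
          ENNReal.inv_mul_cancel hK0 hKt, mul_one]
      calc K ^ (n + 1 + n₀) * a (n + 1 + n₀)
          = K ^ (n + n₀) * K * a (n + n₀ + 1) := by rw [← pow_succ]; congr 2 <;> ring
        _ ≤ K ^ (n + n₀) * K * ((2 * K)⁻¹ * a (n + n₀) + h (n + n₀)) := by
            gcongr
            refine (hrec _).trans ?_
            gcongr
            rw [sq]
            gcongr
            exact (hn₀ (n + n₀) (by omega)).le
        _ = (K * (2 * K)⁻¹) * (K ^ (n + n₀) * a (n + n₀)) + K * (K ^ (n + n₀) * h (n + n₀)) := by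
            ring
        _ = _ := by rw [e]
    · rw [ENNReal.tsum_mul_left]
      refine ENNReal.mul_ne_top hKt (ne_top_of_le_ne_top hs ?_)
      exact ENNReal.tsum_comp_le_tsum_of_injective (add_left_injective n₀) (fun n => K ^ n * h n)
  rw [← ENNReal.summable.sum_add_tsum_nat_add' (k := n₀)]
  refine ENNReal.add_ne_top.2 ⟨?_, htail⟩
  exact ENNReal.sum_ne_top.2 fun n _ => ENNReal.mul_ne_top (ENNReal.pow_ne_top hKt) (hfin n)

/-- The geometric weights `K = 10 ^ s` of the scales below `x` add up to at most a multiple of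
`x ^ s`. -/
lemma tsum_scales_le_rpow {s : ℝ} (hs : 0 < s) {t : ℝ≥0∞} (ht : t ≠ 0) (ht' : t ≠ ∞) :
    ∃ C : ℝ≥0∞, C ≠ ∞ ∧ ∀ x : ℝ≥0∞,
      ∑' n : ℕ, ((10 : ℝ≥0∞) ^ s) ^ n * {y | 10 ^ n * t ≤ y}.indicator 1 x ≤ C * x ^ s := by
  set k : ℝ := 10 ^ s with hk
  have hk1 : 1 < k := Real.one_lt_rpow (by norm_num) hs
  have hK : (10 : ℝ≥0∞) ^ s = ENNReal.ofReal k := by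
    rw [hk, ← ENNReal.ofReal_rpow_of_pos (by norm_num)]
    simp
  set K : ℝ≥0∞ := (10 : ℝ≥0∞) ^ s with hKdef
  set c := ENNReal.ofReal (k / (k - 1)) with hc
  have hcK : c + K = c * K := by
    rw [hK, hc, ← ENNReal.ofReal_add (by apply div_nonneg <;> linarith) (by linarith),
      ← ENNReal.ofReal_mul (by apply div_nonneg <;> linarith)]
    congr 1
    have : k - 1 ≠ 0 := by linarith
    field_simp
    ring
  have hgeom : ∀ N : ℕ, ∑ n ∈ Finset.range (N + 1), K ^ n ≤ c * K ^ N := by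
    intro N
    induction N with
    | zero =>
      simp only [zero_add, Finset.sum_range_one, pow_zero, mul_one]
      rw [hc, ← ENNReal.ofReal_one]
      apply ENNReal.ofReal_le_ofReal
      rw [le_div_iff₀ (by linarith)]
      linarith
    | succ N ih =>
      rw [Finset.sum_range_succ]
      calc _ ≤ c * K ^ N + K ^ (N + 1) := by gcongr
        _ = (c + K) * K ^ N := by ring
        _ = c * K ^ (N + 1) := by rw [hcK]; ring
  refine ⟨c * (t ^ s)⁻¹, ENNReal.mul_ne_top (by simp [hc]) ?_, fun x => ?_⟩
  · simp [ENNReal.rpow_eq_zero_iff, ht, ht', hs]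
  refine ENNReal.tsum_le_of_sum_range_le fun N => ?_
  induction N with
  | zero => simp
  | succ N ih =>
    by_cases hN : 10 ^ N * t ≤ x
    · calc _ ≤ ∑ n ∈ Finset.range (N + 1), K ^ n := by
            gcongr with n
            refine mul_le_of_le_one_right zero_le ?_
            exact Set.indicator_le_self' (by simp) x
        _ ≤ c * K ^ N := hgeom N
        _ ≤ c * ((t ^ s)⁻¹ * x ^ s) := by
            gcongr
            rw [← ENNReal.div_eq_inv_mul, ENNReal.le_div_iff_mul_le
              (Or.inl (by simp [ENNReal.rpow_eq_zero_iff, ht, ht']))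
              (Or.inl (ENNReal.rpow_ne_top_of_nonneg hs.le ht')), hKdef, ← ENNReal.rpow_natCast,
              ← ENNReal.rpow_mul, mul_comm s, ENNReal.rpow_mul,
              ← ENNReal.mul_rpow_of_nonneg _ _ hs.le, ENNReal.rpow_natCast]
            gcongr
        _ = _ := by ring
    · rw [Finset.sum_range_succ, Set.indicator_of_notMem (by exact hN), mul_zero, add_zero]
      exact ih

/-- Conversely, `x ^ s` is at most a multiple of the sum of the weights of the scales below `x`. -/
lemma rpow_le_tsum_scales {s : ℝ} (hs : 0 < s) {t : ℝ≥0∞} (ht : t ≠ 0) (ht' : t ≠ ∞) (x : ℝ≥0∞) :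
    x ^ s ≤ t ^ s + (10 * t) ^ s *
      ∑' n : ℕ, ((10 : ℝ≥0∞) ^ s) ^ n * {y | 10 ^ n * t ≤ y}.indicator 1 x := by
  have hpos : (10 * t) ^ s ≠ 0 := by
    simp [ENNReal.rpow_eq_zero_iff, ht, ENNReal.mul_eq_top, ht']
  rcases lt_or_ge x t with hx | hx
  · exact le_add_right (by gcongr)
  refine le_add_left ?_
  rcases eq_or_ne x ∞ with rfl | hxt
  · have : ∑' n : ℕ, ((10 : ℝ≥0∞) ^ s) ^ n * {y | 10 ^ n * t ≤ y}.indicator 1 (∞ : ℝ≥0∞) = ∞ := by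
      rw [eq_top_iff, ← ENNReal.tsum_const_eq_top_of_ne_zero (α := ℕ) one_ne_zero]
      refine ENNReal.tsum_le_tsum fun n => ?_
      rw [Set.indicator_of_mem (by simp), Pi.one_apply, mul_one]
      exact one_le_pow₀ (ENNReal.one_le_rpow (by norm_num) hs)
    rw [this, ENNReal.mul_top hpos]
    exact le_top
  · have h1 : 1 ≤ (x / t).toReal := by
      rw [← ENNReal.toReal_one]
      refine ENNReal.toReal_mono (ENNReal.div_ne_top hxt ht) ?_
      rwa [ENNReal.le_div_iff_mul_le (Or.inl ht) (Or.inl ht'), one_mul]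
    obtain ⟨n, hn, hn'⟩ := exists_nat_pow_near h1 (by norm_num : (1 : ℝ) < 10)
    have hc : ∀ m : ℕ, ENNReal.ofReal ((10 : ℝ) ^ m) = 10 ^ m := fun m => by
      rw [ENNReal.ofReal_pow (by norm_num)]; simp
    have hlow : 10 ^ n * t ≤ x := by
      rw [← ENNReal.le_div_iff_mul_le (Or.inl ht) (Or.inl ht'), ← hc]
      exact ENNReal.ofReal_le_of_le_toReal hn
    have hup : x ≤ 10 ^ (n + 1) * t := by
      rw [← ENNReal.div_le_iff_le_mul (Or.inl ht) (Or.inl ht'), ← hc]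
      exact ENNReal.le_ofReal_iff_toReal_le (ENNReal.div_ne_top hxt ht) (by positivity) |>.2 hn'.le
    calc x ^ s ≤ (10 ^ (n + 1) * t) ^ s := by gcongr
      _ = (10 * t) ^ s * ((10 : ℝ≥0∞) ^ s) ^ n := by
          rw [← ENNReal.rpow_natCast (_ ^ s), ← ENNReal.rpow_mul, mul_comm s, ENNReal.rpow_mul,
            ENNReal.rpow_natCast, ← ENNReal.mul_rpow_of_nonneg _ _ hs.le]
          congr 1
          ring
      _ ≤ _ := by
          gcongr
          refine le_trans ?_ (ENNReal.le_tsum n)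
          rw [Set.indicator_of_mem (by exact hlow), Pi.one_apply, mul_one]

variable {α : Type*} [MeasurableSpace α] {X : α → ℝ≥0∞}

lemma lintegral_tsum_scales (μ : Measure α) (hX : Measurable X) (K t : ℝ≥0∞) :
    ∫⁻ a, ∑' n : ℕ, K ^ n * {y | 10 ^ n * t ≤ y}.indicator 1 (X a) ∂μ =
      ∑' n : ℕ, K ^ n * μ {a | 10 ^ n * t ≤ X a} := by
  have hm : ∀ n : ℕ, MeasurableSet {y : ℝ≥0∞ | 10 ^ n * t ≤ y} := fun n =>
    measurableSet_le measurable_const measurable_id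
  have hi : ∀ n : ℕ, Measurable fun a => {y : ℝ≥0∞ | 10 ^ n * t ≤ y}.indicator
      (1 : ℝ≥0∞ → ℝ≥0∞) (X a) := fun n => (measurable_one.indicator (hm n)).comp hX
  rw [lintegral_tsum fun n => ((hi n).const_mul _).aemeasurable]
  congr 1
  ext n
  rw [lintegral_const_mul _ (hi n)]
  congr 1
  exact lintegral_indicator_one (hX (hm n))

lemma tsum_measure_scales_ne_top {μ : Measure α} (hX : Measurable X) {s : ℝ} (hs : 0 < s)
    {t : ℝ≥0∞} (ht : t ≠ 0) (ht' : t ≠ ∞) (h : ∫⁻ a, X a ^ s ∂μ ≠ ∞) :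
    ∑' n : ℕ, ((10 : ℝ≥0∞) ^ s) ^ n * μ {a | 10 ^ n * t ≤ X a} ≠ ∞ := by
  obtain ⟨C, hC, hle⟩ := tsum_scales_le_rpow hs ht ht'
  rw [← lintegral_tsum_scales μ hX]
  refine ne_top_of_le_ne_top (ENNReal.mul_ne_top hC h) ?_
  rw [← lintegral_const_mul _ (by fun_prop)]
  exact lintegral_mono fun a => hle (X a)

lemma lintegral_rpow_ne_top_of_scales {μ : Measure α} (hX : Measurable X) {s : ℝ} (hs : 0 < s)
    {t : ℝ≥0∞} (ht : t ≠ 0) (ht' : t ≠ ∞) (hμ : μ Set.univ ≠ ∞)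
    (h : ∑' n : ℕ, ((10 : ℝ≥0∞) ^ s) ^ n * μ {a | 10 ^ n * t ≤ X a} ≠ ∞) :
    ∫⁻ a, X a ^ s ∂μ ≠ ∞ := by
  have hle : ∫⁻ a, X a ^ s ∂μ ≤ t ^ s * μ Set.univ + (10 * t) ^ s *
      ∑' n : ℕ, ((10 : ℝ≥0∞) ^ s) ^ n * μ {a | 10 ^ n * t ≤ X a} := by
    rw [← lintegral_tsum_scales μ hX, ← lintegral_const, ← lintegral_const_mul',
      ← lintegral_add_left measurable_const]
    · exact lintegral_mono fun a => rpow_le_tsum_scales hs ht ht' (X a)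
    · exact ENNReal.rpow_ne_top_of_nonneg hs.le (ENNReal.mul_ne_top (by simp) ht')
  refine ne_top_of_le_ne_top (ENNReal.add_ne_top.2 ⟨ENNReal.mul_ne_top ?_ hμ,
    ENNReal.mul_ne_top ?_ h⟩) hle
  · exact ENNReal.rpow_ne_top_of_nonneg hs.le ht'
  · exact ENNReal.rpow_ne_top_of_nonneg hs.le (ENNReal.mul_ne_top (by simp) ht')

end Scales

/-! ### The scale recursion -/

section Recursion

lemma ten_pow_mul_ofReal (n : ℕ) (t : ℝ) :
    10 ^ n * ENNReal.ofReal t = ENNReal.ofReal (10 ^ n * t) := by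
  rw [ENNReal.ofReal_mul (by positivity), ENNReal.ofReal_pow (by norm_num)]
  simp

lemma setOf_ten_pow_mul_ofReal_le (n : ℕ) (t : ℝ) :
    {r : Set.Ioi (0 : ℝ) | 10 ^ n * ENNReal.ofReal t ≤ ENNReal.ofReal (r : ℝ)} =
      {r : Set.Ioi (0 : ℝ) | 10 ^ n * t ≤ (r : ℝ)} := by
  ext r
  have hr : (0 : ℝ) < r := r.2
  simp only [Set.mem_ofPred_eq]
  rw [ten_pow_mul_ofReal, ENNReal.ofReal_le_ofReal_iff hr.le]

variable {d : ℕ} {Ω : Type*} [MeasurableSpace Ω] {ξ : Ω → Set (MarkedSpace d)} {P : Measure Ω}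
  {ν : Measure (Set.Ioi (0 : ℝ))} {lam : ℝ}

/-- The largest probability of a local crossing on the scale `α`. By stationarity this probability
does not depend on the place; with the supremum this fact is not needed. -/
noncomputable def crossingProb (ξ : Ω → Set (MarkedSpace d)) (P : Measure Ω) (α : ℝ) : ℝ≥0∞ :=
  ⨆ x, P {ω | LocalCrossing (ξ ω) x α}

lemma crossingProb_le [IsProbabilityMeasure ν]
    (h : IsPoissonPointProcess ξ (boolIntensity d lam ν) P) {α : ℝ} (hα : 0 < α) :
    crossingProb ξ P α ≤ ENNReal.ofReal lam * (ENNReal.ofReal ((5 * α) ^ d) *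
      volume (Metric.ball (0 : EuclideanSpace ℝ (Fin d)) 1)) := by
  refine iSup_le fun x => ?_
  rw [← boolIntensity_centresIn (ν := ν) lam x (by positivity)]
  exact (measure_mono fun ω hω => LocalCrossing.nonempty hω).trans
    (h.measure_nonempty_le (measurableSet_centresIn _ _))

/-- Local crossings that use centres in disjoint balls are independent. -/
lemma measure_localCrossing_inter (h : IsPoissonPointProcess ξ (boolIntensity d lam ν) P)
    {x y : EuclideanSpace ℝ (Fin d)} {α : ℝ} (hxy : 5 * α + 5 * α ≤ dist x y) :
    P ({ω | LocalCrossing (ξ ω) x α} ∩ {ω | LocalCrossing (ξ ω) y α}) =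
      P {ω | LocalCrossing (ξ ω) x α} * P {ω | LocalCrossing (ξ ω) y α} := by
  have hd : Disjoint (centresIn x (5 * α)) (centresIn y (5 * α)) :=
    (Metric.ball_disjoint_ball hxy).preimage Prod.fst
  exact (Indep_iff _ _ _).1 (h.indep_voidEvents hd) _ _
    (measurableSet_localCrossing x α fun B hB hBx => measurableSet_nonempty_voidEvents ξ hB hBx)
    (measurableSet_localCrossing y α fun B hB hBy => measurableSet_nonempty_voidEvents ξ hB hBy)

/-- The scale recursion: a crossing on the scale `10 α` needs a ball of radius at least `α` or two
independent crossings on the scale `α`. -/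
lemma crossingProb_ten_mul_le [IsProbabilityMeasure ν]
    (h : IsPoissonPointProcess ξ (boolIntensity d lam ν) P)
    {K : Finset (EuclideanSpace ℝ (Fin d))}
    (hK : Metric.closedBall 0 40 ⊆ ⋃ k ∈ K, Metric.ball k 1) {α : ℝ} (hα : 0 < α) :
    crossingProb ξ P (10 * α) ≤ (K.card : ℝ≥0∞) ^ 2 * crossingProb ξ P α ^ 2 +
      ENNReal.ofReal lam * (ENNReal.ofReal (50 ^ d) *
        volume (Metric.ball (0 : EuclideanSpace ℝ (Fin d)) 1)) *
        coveringMeasure d ν {r | α ≤ (r : ℝ)} := by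
  classical
  refine iSup_le fun x => ?_
  rw [← boolIntensity_bigBalls lam x (by norm_num) α]
  set S := (K ×ˢ K).filter fun q => ‖q.1‖ < 13 ∧ 29 < ‖q.2‖ with hS
  set G := fun k : EuclideanSpace ℝ (Fin d) => {ω | LocalCrossing (ξ ω) (x + α • k) α} with hG
  have hsub : {ω | LocalCrossing (ξ ω) x (10 * α)} ⊆
      (⋃ q ∈ S, G q.1 ∩ G q.2) ∪ {ω | (ξ ω ∩ bigBalls x 50 α).Nonempty} := by
    intro ω hω
    by_cases hb : (ξ ω ∩ bigBalls x 50 α).Nonempty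
    · exact Or.inr hb
    · left
      obtain ⟨k, hk, l, hl, hk', hl', hGk, hGl⟩ := LocalCrossing.exists_pair hα hK
        (fun p hp hpx => by
          by_contra! hlt
          have hpx' : dist p.1 x < 50 * α := hpx
          exact hb ⟨p, hp, hpx'.trans_le (by linarith), hlt⟩) hω
      simp only [Set.mem_iUnion]
      refine ⟨(k, l), ?_, hGk, hGl⟩
      simp [hS, hk, hl, hk', hl']
  have hpair : ∀ q ∈ S, P (G q.1 ∩ G q.2) ≤ crossingProb ξ P α ^ 2 := by
    intro q hq
    simp only [hS, Finset.mem_filter] at hq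
    obtain ⟨-, hq1, hq2⟩ := hq
    have hdist : 5 * α + 5 * α ≤ dist (x + α • q.1) (x + α • q.2) := by
      rw [dist_add_left, dist_eq_norm, ← smul_sub, norm_smul, Real.norm_of_nonneg hα.le]
      have := norm_sub_norm_le q.2 q.1
      rw [norm_sub_rev] at this
      nlinarith
    rw [hG, measure_localCrossing_inter h hdist, sq]
    exact mul_le_mul' (le_iSup (fun x => P {ω | LocalCrossing (ξ ω) x α}) _)
      (le_iSup (fun x => P {ω | LocalCrossing (ξ ω) x α}) _)
  have hcard : (S.card : ℝ≥0∞) ≤ (K.card : ℝ≥0∞) ^ 2 := by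
    have : S.card ≤ K.card ^ 2 :=
      (Finset.card_filter_le _ _).trans (by rw [Finset.card_product, sq])
    exact_mod_cast this
  calc P {ω | LocalCrossing (ξ ω) x (10 * α)}
      ≤ P (⋃ q ∈ S, G q.1 ∩ G q.2) + P {ω | (ξ ω ∩ bigBalls x 50 α).Nonempty} :=
        (measure_mono hsub).trans (measure_union_le _ _)
    _ ≤ ∑ q ∈ S, P (G q.1 ∩ G q.2) + boolIntensity d lam ν (bigBalls x 50 α) :=
        add_le_add (measure_biUnion_finset_le _ _)
          (h.measure_nonempty_le (measurableSet_bigBalls _ _ _))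
    _ ≤ ∑ q ∈ S, crossingProb ξ P α ^ 2 + boolIntensity d lam ν (bigBalls x 50 α) := by
        gcongr with q hq
        exact hpair q hq
    _ ≤ (K.card : ℝ≥0∞) ^ 2 * crossingProb ξ P α ^ 2 +
          boolIntensity d lam ν (bigBalls x 50 α) := by
        rw [Finset.sum_const, nsmul_eq_mul]
        gcongr

lemma measure_lt_clusterDiam_le [IsProbabilityMeasure ν]
    (h : IsPoissonPointProcess ξ (boolIntensity d lam ν) P) {α : ℝ} (hα : 0 < α) :
    P {ω | ENNReal.ofReal (8 * α) < clusterDiam (ξ ω)} ≤ crossingProb ξ P α +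
      ENNReal.ofReal lam * (ENNReal.ofReal (50 ^ d) *
        volume (Metric.ball (0 : EuclideanSpace ℝ (Fin d)) 1)) *
        coveringMeasure d ν {r | α ≤ (r : ℝ)} := by
  have hsub : {ω | ENNReal.ofReal (8 * α) < clusterDiam (ξ ω)} ⊆
      {ω | LocalCrossing (ξ ω) 0 α} ∪ {ω | (ξ ω ∩ bigBalls 0 5 α).Nonempty} :=
    fun ω hω => localCrossing_or_of_lt_clusterDiam hα hω
  refine (measure_mono hsub).trans ((measure_union_le _ _).trans (add_le_add ?_ ?_))
  · exact le_iSup (fun x => P {ω | LocalCrossing (ξ ω) x α}) 0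
  · refine (h.measure_nonempty_le (measurableSet_bigBalls _ _ _)).trans ?_
    rw [boolIntensity_bigBalls lam 0 (by norm_num) α]
    gcongr
    norm_num

/-- Subcriticality: below an intensity of the order of the inverse of `∫ r ^ d ν(dr)`, the
diameter of the cluster has a moment of order `s` as soon as `ν` has one of order `d + s`. -/
lemma lintegral_clusterDiam_rpow_ne_top [IsProbabilityMeasure ν] (hd : 1 ≤ d)
    (h : IsPoissonPointProcess ξ (boolIntensity d lam ν) P)
    {K : Finset (EuclideanSpace ℝ (Fin d))}
    (hK : Metric.closedBall 0 40 ⊆ ⋃ k ∈ K, Metric.ball k 1) (hK1 : 1 ≤ K.card)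
    (hlam : (K.card : ℝ≥0∞) ^ 2 * (ENNReal.ofReal lam * (ENNReal.ofReal (50 ^ d) *
      volume (Metric.ball (0 : EuclideanSpace ℝ (Fin d)) 1)) * radiusMoment ν d) ≤ 4⁻¹)
    {s : ℝ} (hs : 0 < s) (hν : radiusMoment ν (d + s) ≠ ∞) :
    ∫⁻ ω, clusterDiam (ξ ω) ^ s ∂P ≠ ∞ := by
  have := h.isProbabilityMeasure
  set v := volume (Metric.ball (0 : EuclideanSpace ℝ (Fin d)) 1) with hv
  have hvt : v ≠ ∞ := measure_ball_lt_top.ne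
  set N : ℝ≥0∞ := (K.card : ℝ≥0∞) ^ 2 with hN
  have hN1 : 1 ≤ N := one_le_pow₀ (by exact_mod_cast hK1)
  have hNt : N ≠ ∞ := ENNReal.pow_ne_top (by simp)
  -- on a scale `α` that is small enough, a ball with centre in `B(x, 5 α)` is itself unlikely
  obtain ⟨α, hα, hα0⟩ : ∃ α : ℝ, 0 < α ∧
      N * (ENNReal.ofReal lam * (ENNReal.ofReal ((5 * α) ^ d) * v)) ≤ 2⁻¹ := by
    set c := (N * (ENNReal.ofReal lam * v)).toReal with hc
    have hc0 : 0 ≤ c := ENNReal.toReal_nonneg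
    refine ⟨1 / (5 * (2 * c + 1)), by positivity, ?_⟩
    have e : 5 * (1 / (5 * (2 * c + 1))) = (2 * c + 1)⁻¹ := by field_simp
    have hpow : ((2 * c + 1)⁻¹) ^ d ≤ (2 * c + 1)⁻¹ :=
      pow_le_of_le_one (by positivity) (inv_le_one_of_one_le₀ (by linarith)) (by omega)
    calc N * (ENNReal.ofReal lam * (ENNReal.ofReal ((5 * (1 / (5 * (2 * c + 1)))) ^ d) * v))
        = (N * (ENNReal.ofReal lam * v)) * ENNReal.ofReal (((2 * c + 1)⁻¹) ^ d) := by
          rw [e]; ring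
      _ = ENNReal.ofReal (c * ((2 * c + 1)⁻¹) ^ d) := by
          rw [ENNReal.ofReal_mul hc0, hc, ENNReal.ofReal_toReal]
          exact ENNReal.mul_ne_top hNt (ENNReal.mul_ne_top (by simp) hvt)
      _ ≤ ENNReal.ofReal 2⁻¹ := by
          apply ENNReal.ofReal_le_ofReal
          calc c * ((2 * c + 1)⁻¹) ^ d ≤ c * (2 * c + 1)⁻¹ := by gcongr
            _ ≤ 2⁻¹ := by
              rw [← div_eq_mul_inv, div_le_iff₀ (by positivity)]
              linarith
      _ = 2⁻¹ := by rw [ENNReal.ofReal_inv_of_pos (by norm_num)]; simp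
  set g : ℕ → ℝ≥0∞ := fun n => ENNReal.ofReal lam * (ENNReal.ofReal (50 ^ d) * v) *
    coveringMeasure d ν {r | 10 ^ n * α ≤ (r : ℝ)} with hg
  have hK10 : 1 ≤ (10 : ℝ≥0∞) ^ s := ENNReal.one_le_rpow (by norm_num) hs
  have hK10t : (10 : ℝ≥0∞) ^ s ≠ ∞ := ENNReal.rpow_ne_top_of_nonneg hs.le (by simp)
  have hgsum : ∑' n, ((10 : ℝ≥0∞) ^ s) ^ n * (N * g n) ≠ ∞ := by
    have h1 := tsum_measure_scales_ne_top (μ := coveringMeasure d ν)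
      (X := fun r : Set.Ioi (0 : ℝ) => ENNReal.ofReal (r : ℝ)) (by fun_prop) hs
      (t := ENNReal.ofReal α) (by simpa using hα) (by simp)
      (by rwa [lintegral_rpow_coveringMeasure])
    simp only [setOf_ten_pow_mul_ofReal_le] at h1
    have e2 : ∀ n, ((10 : ℝ≥0∞) ^ s) ^ n * (N * g n) =
        (N * (ENNReal.ofReal lam * (ENNReal.ofReal (50 ^ d) * v))) *
        (((10 : ℝ≥0∞) ^ s) ^ n * coveringMeasure d ν {r | 10 ^ n * α ≤ (r : ℝ)}) := by
      intro n
      simp only [hg]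
      ring
    simp only [e2]
    rw [ENNReal.tsum_mul_left]
    exact ENNReal.mul_ne_top (ENNReal.mul_ne_top hNt (ENNReal.mul_ne_top (by simp)
      (ENNReal.mul_ne_top (by simp) hvt))) h1
  have hasum : ∑' n, ((10 : ℝ≥0∞) ^ s) ^ n * (N * crossingProb ξ P (10 ^ n * α)) ≠ ∞ := by
    refine tsum_geometric_mul_ne_top_of_quadratic hK10 hK10t ?_ (fun n => ?_) (fun n => ?_) hgsum
    · refine le_trans ?_ hα0
      rw [pow_zero, one_mul]
      gcongr
      exact crossingProb_le h hα
    · have := crossingProb_ten_mul_le h hK (α := 10 ^ n * α) (by positivity)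
      calc N * crossingProb ξ P (10 ^ (n + 1) * α)
          = N * crossingProb ξ P (10 * (10 ^ n * α)) := by rw [pow_succ']; ring_nf
        _ ≤ N * (N * crossingProb ξ P (10 ^ n * α) ^ 2 + g n) := by gcongr
        _ = (N * crossingProb ξ P (10 ^ n * α)) ^ 2 + N * g n := by ring
    · refine le_trans ?_ hlam
      rw [← coveringMeasure_univ]
      simp only [hg]
      gcongr
      exact Set.subset_univ _
  have hD : Measurable fun ω => clusterDiam (ξ ω) :=
    measurable_clusterDiam fun B hB => h.measurableSet_nonempty hB
  refine lintegral_rpow_ne_top_of_scales hD hs (t := ENNReal.ofReal (16 * α))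
    (by simpa using hα) ENNReal.ofReal_ne_top (by simp) ?_
  refine ne_top_of_le_ne_top (ENNReal.add_ne_top.2 ⟨hasum, hgsum⟩) ?_
  rw [← ENNReal.tsum_add]
  refine ENNReal.tsum_le_tsum fun n => ?_
  rw [← mul_add]
  gcongr
  have hsub : {ω | 10 ^ n * ENNReal.ofReal (16 * α) ≤ clusterDiam (ξ ω)} ⊆
      {ω | ENNReal.ofReal (8 * (10 ^ n * α)) < clusterDiam (ξ ω)} := by
    intro ω hω
    simp only [Set.mem_ofPred_eq] at hω ⊢
    refine lt_of_lt_of_le ?_ hω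
    have : (0 : ℝ) < 10 ^ n * α := by positivity
    rw [ten_pow_mul_ofReal, ENNReal.ofReal_lt_ofReal_iff (by positivity)]
    linarith
  refine (measure_mono hsub).trans ((measure_lt_clusterDiam_le h (by positivity)).trans ?_)
  exact add_le_add (le_mul_of_one_le_left zero_le hN1) (le_mul_of_one_le_left zero_le hN1)

end Recursion

/-! ### Necessity of the moment condition -/

section Necessity

variable {d : ℕ} {Ω : Type*} [MeasurableSpace Ω] {ξ : Ω → Set (MarkedSpace d)} {P : Measure Ω}
  {ν : Measure (Set.Ioi (0 : ℝ))} {lam : ℝ}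

/-- The ball that covers the origin may be large: as the diameter of the cluster dominates its
radius, a moment of the diameter forces the corresponding moment of the radii. -/
lemma radiusMoment_ne_top_of_lintegral_clusterDiam [IsProbabilityMeasure ν] (hd : 1 ≤ d)
    (hlam : 0 < lam) (h : IsPoissonPointProcess ξ (boolIntensity d lam ν) P) {s : ℝ} (hs : 0 < s)
    (hE : ∫⁻ ω, clusterDiam (ξ ω) ^ s ∂P ≠ ∞) : radiusMoment ν (d + s) ≠ ∞ := by
  have := h.isProbabilityMeasure
  have hD : Measurable fun ω => clusterDiam (ξ ω) :=
    measurable_clusterDiam fun B hB => h.measurableSet_nonempty hB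
  set v := volume (Metric.ball (0 : EuclideanSpace ℝ (Fin d)) 1) with hv
  have hv0 : v ≠ 0 := (Metric.measure_ball_pos volume _ one_pos).ne'
  set c := ENNReal.ofReal lam * (ENNReal.ofReal (1 ^ d) * v) with hc
  have hc0 : c ≠ 0 := by simp [hc, hv0, hlam]
  -- by Markov's inequality the diameter exceeds `t` with probability at most `1 / 2`
  obtain ⟨t, ht, hPt⟩ : ∃ t : ℝ, 0 < t ∧ P {ω | ENNReal.ofReal t ≤ clusterDiam (ξ ω)} ≤ 2⁻¹ := by
    set E := ∫⁻ ω, clusterDiam (ξ ω) ^ s ∂P with hEdef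
    have hε0 : 0 < 2 * E.toReal + 1 := by positivity
    refine ⟨(2 * E.toReal + 1) ^ s⁻¹, by positivity, ?_⟩
    have hmk := mul_meas_ge_le_lintegral (μ := P) (hD.pow_const s)
      (ENNReal.ofReal (2 * E.toReal + 1))
    have hset : {ω | ENNReal.ofReal ((2 * E.toReal + 1) ^ s⁻¹) ≤ clusterDiam (ξ ω)} =
        {ω | ENNReal.ofReal (2 * E.toReal + 1) ≤ clusterDiam (ξ ω) ^ s} := by
      ext ω
      simp only [Set.mem_ofPred_eq]
      rw [← ENNReal.ofReal_rpow_of_pos hε0, ENNReal.rpow_inv_le_iff hs]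
    rw [hset]
    have h2E : 2 * E ≤ ENNReal.ofReal (2 * E.toReal + 1) := by
      rw [ENNReal.ofReal_add (by positivity) (by norm_num), ENNReal.ofReal_mul (by norm_num),
        ENNReal.ofReal_toReal hE]
      simp
    have hε : ENNReal.ofReal (2 * E.toReal + 1) ≠ 0 := by simpa using hε0
    calc P {ω | ENNReal.ofReal (2 * E.toReal + 1) ≤ clusterDiam (ξ ω) ^ s}
        ≤ E / ENNReal.ofReal (2 * E.toReal + 1) := by
          rw [ENNReal.le_div_iff_mul_le (Or.inl hε) (Or.inl (by simp)), mul_comm]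
          exact hmk
      _ ≤ 2⁻¹ := by
          rw [ENNReal.div_le_iff_le_mul (Or.inl hε) (Or.inl (by simp))]
          calc E = 2⁻¹ * (2 * E) := by
                rw [← mul_assoc, ENNReal.inv_mul_cancel (by simp) (by simp), one_mul]
            _ ≤ _ := by gcongr
  have htail : ∀ τ : ℝ, t ≤ τ → c * coveringMeasure d ν {r | τ ≤ (r : ℝ)} ≤
      2 * P {ω | ENNReal.ofReal τ ≤ clusterDiam (ξ ω)} := by
    intro τ hτ
    have hsub : {ω | (ξ ω ∩ bigBalls 0 1 τ).Nonempty} ⊆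
        {ω | ENNReal.ofReal τ ≤ clusterDiam (ξ ω)} := by
      rintro ω ⟨p, hp, hp1, hp2⟩
      rw [dist_comm, one_mul] at hp1
      exact (ENNReal.ofReal_le_ofReal hp2).trans (le_clusterDiam hd hp hp1)
    have hsub' : {ω | ENNReal.ofReal τ ≤ clusterDiam (ξ ω)} ⊆
        {ω | ENNReal.ofReal t ≤ clusterDiam (ξ ω)} :=
      fun ω hω => (ENNReal.ofReal_le_ofReal hτ).trans hω
    rw [hc, ← boolIntensity_bigBalls lam 0 one_pos τ]
    refine (h.le_two_mul_measure_nonempty (measurableSet_bigBalls _ _ _)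
      (((measure_mono hsub).trans (measure_mono hsub')).trans hPt)).trans ?_
    gcongr
  have hmass : coveringMeasure d ν Set.univ ≠ ∞ := by
    have hm : MeasurableSet {r : Set.Ioi (0 : ℝ) | t ≤ (r : ℝ)} :=
      measurableSet_le measurable_const measurable_subtype_coe
    rw [← measure_add_measure_compl hm]
    refine ENNReal.add_ne_top.2 ⟨fun htop => ?_, ?_⟩
    · have := htail t le_rfl
      rw [htop, ENNReal.mul_top hc0, top_le_iff] at this
      exact ENNReal.mul_ne_top (by simp) (measure_ne_top P _) this
    · rw [coveringMeasure, withDensity_apply _ hm.compl]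
      refine ne_top_of_le_ne_top (ENNReal.ofReal_ne_top (r := t ^ d)) ?_
      calc ∫⁻ r in {r : Set.Ioi (0 : ℝ) | t ≤ (r : ℝ)}ᶜ, ENNReal.ofReal ((r : ℝ) ^ d) ∂ν
          ≤ ∫⁻ r in {r : Set.Ioi (0 : ℝ) | t ≤ (r : ℝ)}ᶜ, ENNReal.ofReal (t ^ d) ∂ν := by
            refine setLIntegral_mono measurable_const fun r hr => ?_
            have hr0 : (0 : ℝ) < r := r.2
            have hrt : (r : ℝ) < t := not_le.1 hr
            gcongr
        _ ≤ ENNReal.ofReal (t ^ d) := by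
            rw [setLIntegral_const]
            exact mul_le_of_le_one_right zero_le prob_le_one
  rw [← lintegral_rpow_coveringMeasure]
  refine lintegral_rpow_ne_top_of_scales (by fun_prop) hs (t := ENNReal.ofReal t)
    (by simpa using ht) (by simp) hmass ?_
  have hsum := tsum_measure_scales_ne_top hD hs (t := ENNReal.ofReal t)
    (by simpa using ht) (by simp) hE
  have hle : c * ∑' n : ℕ, ((10 : ℝ≥0∞) ^ s) ^ n * coveringMeasure d ν
      {r | 10 ^ n * ENNReal.ofReal t ≤ ENNReal.ofReal (r : ℝ)} ≤
      2 * ∑' n : ℕ, ((10 : ℝ≥0∞) ^ s) ^ n *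
        P {ω | 10 ^ n * ENNReal.ofReal t ≤ clusterDiam (ξ ω)} := by
    rw [← ENNReal.tsum_mul_left, ← ENNReal.tsum_mul_left]
    refine ENNReal.tsum_le_tsum fun n => ?_
    rw [setOf_ten_pow_mul_ofReal_le, ten_pow_mul_ofReal, mul_left_comm c, mul_left_comm 2]
    refine mul_le_mul' le_rfl (htail _ (le_mul_of_one_le_left ht.le
      (one_le_pow₀ (by norm_num : (1 : ℝ) ≤ 10))))
  intro htop
  rw [htop, ENNReal.mul_top hc0, top_le_iff] at hle
  exact ENNReal.mul_ne_top (by simp) hsum hle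

end Necessity

/-! ### The equivalence -/

lemma radiusMoment_ne_top_of_add {ν : Measure (Set.Ioi (0 : ℝ))} [IsProbabilityMeasure ν] {d : ℕ}
    {s : ℝ} (hs : 0 < s) (hν : radiusMoment ν (d + s) ≠ ∞) : radiusMoment ν d ≠ ∞ := by
  have hle : radiusMoment ν d ≤ 1 + radiusMoment ν (d + s) := by
    calc radiusMoment ν d ≤ ∫⁻ r, (1 + ENNReal.ofReal ((r : ℝ) ^ ((d : ℝ) + s))) ∂ν := by
          refine lintegral_mono fun r => ?_
          have hr : (0 : ℝ) < r := r.2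
          rcases le_total (r : ℝ) 1 with h1 | h1
          · refine le_add_right ?_
            rw [ENNReal.ofReal_le_one]
            exact Real.rpow_le_one hr.le h1 (by positivity)
          · refine le_add_left (ENNReal.ofReal_le_ofReal ?_)
            exact Real.rpow_le_rpow_of_exponent_le h1 (by linarith)
      _ = 1 + radiusMoment ν (d + s) := by
          rw [lintegral_add_left measurable_const]
          simp [radiusMoment]
  exact ne_top_of_le_ne_top (ENNReal.add_ne_top.2 ⟨by simp, hν⟩) hle

lemma radiusMoment_ne_zero {ν : Measure (Set.Ioi (0 : ℝ))} [IsProbabilityMeasure ν] (p : ℝ) :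
    radiusMoment ν p ≠ 0 := by
  rw [radiusMoment, Ne, lintegral_eq_zero_iff (by fun_prop)]
  intro h0
  obtain ⟨r, hr⟩ := h0.exists
  have hr0 : (0 : ℝ) < r := r.2
  have := Real.rpow_pos_of_pos hr0 p
  simp only [Pi.zero_apply, ENNReal.ofReal_eq_zero] at hr
  linarith

/-- The constant depends on the dimension only: it is made of the volume of the unit ball and of
the number of unit balls that cover a ball of radius `40`. -/
lemma exists_subcritical_constant (d : ℕ) (hd : 1 ≤ d) : ∃ C : ℝ, 0 < C ∧
    ∀ (s : ℝ), 0 < s → ∀ (ν : Measure (Set.Ioi (0 : ℝ))), IsProbabilityMeasure ν →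
      radiusMoment ν (d + s) < ∞ →
      ∀ lam : ℝ, ENNReal.ofReal lam < ENNReal.ofReal C * (radiusMoment ν d)⁻¹ →
        ∀ (Ω : Type u) [MeasurableSpace Ω] (ξ : Ω → Set (MarkedSpace d)) (P : Measure Ω),
          IsPoissonPointProcess ξ (boolIntensity d lam ν) P →
          ∫⁻ ω, clusterDiam (ξ ω) ^ s ∂P < ∞ := by
  obtain ⟨K, -, hK⟩ := (isCompact_closedBall (0 : EuclideanSpace ℝ (Fin d)) 40).elim_nhds_subcover
    (fun k => Metric.ball k 1) fun k _ => Metric.ball_mem_nhds k one_pos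
  have hK1 : 1 ≤ K.card := by
    rw [Finset.one_le_card]
    have h0 := hK (Metric.mem_closedBall_self (by norm_num))
    simp only [Set.mem_iUnion] at h0
    obtain ⟨k, hk, _⟩ := h0
    exact ⟨k, hk⟩
  set A : ℝ≥0∞ := (K.card : ℝ≥0∞) ^ 2 * (ENNReal.ofReal (50 ^ d) *
    volume (Metric.ball (0 : EuclideanSpace ℝ (Fin d)) 1)) with hA
  have hAt : A ≠ ∞ := ENNReal.mul_ne_top (ENNReal.pow_ne_top (by simp))
    (ENNReal.mul_ne_top (by simp) measure_ball_lt_top.ne)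
  have hA0 : A ≠ 0 := by
    refine mul_ne_zero (pow_ne_zero _ (by exact_mod_cast (by omega : K.card ≠ 0)))
      (mul_ne_zero (by simp) (Metric.measure_ball_pos volume _ one_pos).ne')
  have hAC : (4 * A)⁻¹ ≠ ∞ := by simp [hA0]
  refine ⟨((4 * A)⁻¹).toReal, ENNReal.toReal_pos ?_ hAC, ?_⟩
  · exact ENNReal.inv_ne_zero.2 (ENNReal.mul_ne_top (by simp) hAt)
  intro s hs ν _ hν lam hlam Ω _ ξ P h
  rw [ENNReal.ofReal_toReal hAC, ← div_eq_mul_inv] at hlam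
  refine (lintegral_clusterDiam_rpow_ne_top hd h hK hK1 ?_ hs hν.ne).lt_top
  have hmul : ENNReal.ofReal lam * radiusMoment ν d ≤ (4 * A)⁻¹ := ENNReal.mul_le_of_le_div hlam.le
  calc _ = A * (ENNReal.ofReal lam * radiusMoment ν d) := by rw [hA]; ring
    _ ≤ A * (4 * A)⁻¹ := by gcongr
    _ = 4⁻¹ := by
      rw [ENNReal.mul_inv (by simp) (by simp), mul_left_comm,
        ENNReal.mul_inv_cancel hA0 hAt, mul_one]

theorem theorem2p2 (d : ℕ) (hd : 1 ≤ d) :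
    (∀ (s : ℝ), 0 < s → ∀ (ν : Measure (Set.Ioi (0 : ℝ))), IsProbabilityMeasure ν →
      ∀ (Ω : Type u) [MeasurableSpace Ω] (ξ : Ω → Set (MarkedSpace d)) (P : ℝ → Measure Ω),
        (∀ lam : ℝ, 0 < lam → IsPoissonPointProcess ξ (boolIntensity d lam ν) (P lam)) →
        Measurable (fun ω => clusterDiam (ξ ω)) ∧
        (radiusMoment ν (d + s) < ∞ ↔
          ∃ lam₀ : ℝ, 0 < lam₀ ∧ ∀ lam : ℝ, 0 < lam → lam < lam₀ →
            ∫⁻ ω, clusterDiam (ξ ω) ^ s ∂(P lam) < ∞)) ∧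
    (∃ C : ℝ, 0 < C ∧
      ∀ (s : ℝ), 0 < s → ∀ (ν : Measure (Set.Ioi (0 : ℝ))), IsProbabilityMeasure ν →
        radiusMoment ν (d + s) < ∞ →
        ∀ lam : ℝ, 0 < lam → ENNReal.ofReal lam < ENNReal.ofReal C * (radiusMoment ν d)⁻¹ →
          ∀ (Ω : Type u) [MeasurableSpace Ω] (ξ : Ω → Set (MarkedSpace d)) (P : Measure Ω),
            IsPoissonPointProcess ξ (boolIntensity d lam ν) P →
            ∫⁻ ω, clusterDiam (ξ ω) ^ s ∂P < ∞) := by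
  obtain ⟨C, hC, hfin⟩ := exists_subcritical_constant.{u} d hd
  refine ⟨?_, C, hC, fun s hs ν hν hmom lam _ hlam => hfin s hs ν hν hmom lam hlam⟩
  intro s hs ν hν Ω _ ξ P hP
  refine ⟨measurable_clusterDiam fun B hB => (hP 1 one_pos).measurableSet_nonempty hB, ?_, ?_⟩
  · intro hmom
    have hm : radiusMoment ν d ≠ ∞ := radiusMoment_ne_top_of_add hs hmom.ne
    have hm0 : 0 < (radiusMoment ν d).toReal := ENNReal.toReal_pos (radiusMoment_ne_zero _) hm
    refine ⟨C / (radiusMoment ν d).toReal, by positivity, fun lam hlam hlt =>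
      hfin s hs ν hν hmom lam ?_ Ω ξ (P lam) (hP lam hlam)⟩
    rw [← div_eq_mul_inv, ← ENNReal.ofReal_toReal hm, ← ENNReal.ofReal_div_of_pos hm0]
    exact (ENNReal.ofReal_lt_ofReal_iff (by positivity)).2 hlt
  · rintro ⟨lam₀, h0, h⟩
    exact (radiusMoment_ne_top_of_lintegral_clusterDiam hd (half_pos h0) (hP _ (half_pos h0)) hs
      (h _ (half_pos h0) (half_lt_self h0)).ne).lt_top
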